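/- **Setting.** There are $n$ replicas, at most $f$ of which are Byzantine (arbitrary behaviour); the others are correct. Let $\tfrac12<\gamma\le 1$ and $n>\frac{(2\gamma+1)f}{2\gamma-1}$. Each transaction $T$ has a digest. *DAG layer.* FairDAG-RL runs on top of a DAG-based consensus protocol. A correct replica appends the digest of each valid transaction it receives, paired with the next value of a local counter (its ordering indicator), to its pending local ordering. In each round it may reliably broadcast one vertex, which carries (and clears) the pending local ordering and references at least $n-f$ vertices of the previous round (strong edges, one of them to its own previous vertex; none in round $0$) and at most $f$ vertices of earlier rounds (weak edges). Reliable broadcast delivers no two different vertices with the same source and round to correct replicas, and delivers a vertex of a correct source only if that source broadcast it. A correct replica adds a delivered valid vertex to its local DAG once all vertices it references are there. From time to time it commits a leader vertex $L_r$ (of round $r$) of its local DAG; the subdag $A_r$, consisting of the vertices reachable from $L_r$ (including $L_r$) but not from a previously committed leader, is then sent to its fairness layer, which handles all subdags it is sent, in this order. The consensus protocol guarantees, for leader vertices: - *Agreement*: if a correct replica commits $L_r$, every correct replica eventually commits $L_r$. - *Total ascending order*: if a correct replica commits $L_r$ before $L_{r'}$, then $r<r'$ and no correct replica commits $L_{r'}$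 before $L_r$. *Fairness layer.* All correct replicas run the same deterministic code. All loops over sets run in some fixed deterministic order, with vertices in round-increasing order. For each digest $d$ and replica $i$ it stores the committed ordering indicator $oi_i(d)$ (initially $\infty$) and the round in which it was committed; $ap(d,r)$ is the number of $i$ whose indicator for $d$ was committed in a round $\le r$, and $\mathrm{weight}(d,d')=|\{i: oi_i(d)<oi_i(d')\}|$. All digests are initially *blank*; those already ordered are ignored. On receiving $A_r$: 1. A new empty dependency graph $G_r$ is put at the end of a queue, and the indicators in $A_r$ are recorded. Each blank digest $d$ occurring in $A_r$ becomes *solid* if $ap(d,r)\ge n-f$, otherwise *shaded* if $ap(d,r)\ge\frac{n-f}2$; if it became solid or shaded, it is added as a node to $G_r$. 2. For each digest $d$ occurring in $A_r$ and each other node $d'$ of the queued graph containing $d$, the pair $(d,d')$ is selected if $\mathrm{weight}(d,d')$ or $\mathrm{weight}(d',d)$ is at least $\frac{n-f}2$. For each selected pair with no edge between its two nodes yet, the edge $d\to d'$ is added if $\mathrm{weight}(d,d')\ge\mathrm{weight}(d',d)$, and $d'\to d$ otherwise. 3. While the graph at the front of the queue is a tournament (some edge between any two distinct nodes), it is removed,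 and its strongly connected components are listed in topological order $S_1,\dots,S_s$. Let $S_{last}$ be the last one containing a solid node ($last=0$ if there is none). For $j=1,\dots,last$, a Hamilton path of $S_j$, computed by a deterministic subroutine, is appended to the final ordering and its digests become ordered. The nodes of $S_{last+1},\dots,S_s$ are added again to the next graph $G_{r'}$ of the queue (or, if the queue is empty, to the next graph that is created, at the start of step 3): each such $d$ becomes solid if $ap(d,r')\ge n-f$, otherwise shaded if $ap(d,r')\ge\frac{n-f}2$, and the edges between $d$ and the nodes of $G_{r'}$ are added by the same rule as in step 2. **Theorem (FairDAG-RL safety).** In every execution of FairDAG-RL, if a correct replica orders a transaction $T$ at position $p$, i.e. at some time the digest of $T$ is at position $p$ of its final ordering, then every correct replica eventually orders $T$ at position $p$: from some time on, the digest of $T$ is at position $p$ of its final ordering. -/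

import Mathlib

namespace FairDAG

/-! ### Vertices of the DAG -/

/-- A vertex of the DAG, proposed by the replica `source` in round `round`. Its payload is a slice
of the local ordering of that replica: transaction digests paired with ordering indicators.
`strong` lists the sources of the referenced vertices of the previous round, `weak` the pairs
(source, round) of the referenced vertices of earlier rounds. -/
structure Vertex (n : ℕ) (D : Type*) where
  source : Fin n
  round : ℕ
  localOrder : List (D × ℕ)
  strong : Finset (Fin n)
  weak : Finset (Fin n × ℕ)

noncomputable instance (n : ℕ) (D : Type*) : DecidableEq (Vertex n D) := Classical.decEq _

namespace Vertex

variable {n : ℕ} {D : Type*}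

/-- `v` holds a (strong or weak) reference to the vertex `w`. -/
def References (v w : Vertex n D) : Prop :=
  (w.round + 1 = v.round ∧ w.source ∈ v.strong) ∨ (w.source, w.round) ∈ v.weak

/-- Well-formed vertices: after round `0` there are at least `n - f` strong edges, among them one to
the previous vertex of the same replica, and at most `f` weak edges, to rounds before the previous
one. -/
def Valid (f : ℕ) (v : Vertex n D) : Prop :=
  (v.round = 0 ∧ v.strong = ∅ ∧ v.weak = ∅) ∨
  (0 < v.round ∧ n ≤ v.strong.card + f ∧ v.source ∈ v.strong ∧
    v.weak.card ≤ f ∧ ∀ w ∈ v.weak, w.2 + 1 < v.round)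

/-- Every vertex that `v` refers to is present in the local view `dag`. -/
def RefsPresent (dag : Finset (Vertex n D)) (v : Vertex n D) : Prop :=
  (∀ i ∈ v.strong, ∃ w ∈ dag, w.source = i ∧ w.round + 1 = v.round) ∧
  (∀ q ∈ v.weak, ∃ w ∈ dag, w.source = q.1 ∧ w.round = q.2)

end Vertex

open Classical in
/-- The causal history of `L` in the local view `dag`: the vertices that are reachable from `L`
along references, including `L` itself. -/
noncomputable def causalHistory {n : ℕ} {D : Type*} (dag : Finset (Vertex n D))
    (L : Vertex n D) : Finset (Vertex n D) :=
  dag.filter fun w =>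
    Relation.ReflTransGen (fun a b => b ∈ dag ∧ Vertex.References a b) L w

/-- The subdag of the leader `L`: its causal history without the causal histories of the
leaders in `earlier`, which were committed before. -/
noncomputable def subdag {n : ℕ} {D : Type*} (dag : Finset (Vertex n D))
    (earlier : List (Vertex n D)) (L : Vertex n D) : Finset (Vertex n D) :=
  causalHistory dag L \ earlier.toFinset.biUnion (causalHistory dag)

/-! ### Directed graphs on digests -/

section Graphs

variable {D : Type*}

/-- There is an edge between any two distinct nodes. -/
abbrev IsTournament (nodes : Finset D) (edges : Finset (D × D)) : Prop :=
  ∀ a ∈ nodes, ∀ b ∈ nodes, a ≠ b → (a, b) ∈ edges ∨ (b, a) ∈ edges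

/-- There is a directed path from `a` to `b` inside `nodes`. -/
def Reaches (nodes : Finset D) (edges : Finset (D × D)) (a b : D) : Prop :=
  Relation.ReflTransGen (fun x y => x ∈ nodes ∧ y ∈ nodes ∧ (x, y) ∈ edges) a b

/-- `S` is a strongly connected component of the graph. -/
def IsSCC (nodes : Finset D) (edges : Finset (D × D)) (S : Finset D) : Prop :=
  S.Nonempty ∧ S ⊆ nodes ∧
  ∀ a ∈ S, ∀ b ∈ nodes, b ∈ S ↔ (Reaches nodes edges a b ∧ Reaches nodes edges b a)

/-- `L` lists all strongly connected components, once each, in a topological order of the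
condensed graph. -/
def IsSortedCondensation (nodes : Finset D) (edges : Finset (D × D))
    (L : List (Finset D)) : Prop :=
  L.Nodup ∧ (∀ S, S ∈ L ↔ IsSCC nodes edges S) ∧
  L.Pairwise fun S S' => ∀ a ∈ S, ∀ b ∈ S', (b, a) ∉ edges

/-- `l` is a directed path that visits every node of `S` exactly once. -/
def IsHamiltonPath (S : Finset D) (edges : Finset (D × D)) (l : List D) : Prop :=
  l.Nodup ∧ (∀ d, d ∈ l ↔ d ∈ S) ∧ l.IsChain fun a b => (a, b) ∈ edges

end Graphs

/-! ### Deterministic subroutines -/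

/-- `iter` runs through the elements of any finite set, once each. -/
def Enumerates {α : Type*} (iter : Finset α → List α) : Prop :=
  ∀ s, (iter s).Nodup ∧ ∀ a, a ∈ iter s ↔ a ∈ s

/-- The deterministic subroutines that are part of the common code of all correct replicas: the
order in which loops run through finite sets (vertices of a subdag in round-increasing order),
the computation of the sorted condensation of a tournament, and the computation of a Hamilton
path in a strongly connected tournament. Any choice that meets these specifications is
allowed. -/
structure Subroutines (n : ℕ) (D : Type*) where
  vertexIter : Finset (Vertex n D) → List (Vertex n D)
  vertexIter_enumerates : Enumerates vertexIter
  vertexIter_sorted : ∀ A, (vertexIter A).Pairwise fun v w => v.round ≤ w.round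
  digestIter : Finset D → List D
  digestIter_enumerates : Enumerates digestIter
  pairIter : Finset (D × D) → List (D × D)
  pairIter_enumerates : Enumerates pairIter
  sccSort : Finset D → Finset (D × D) → List (Finset D)
  sccSort_spec : ∀ nodes edges, IsTournament nodes edges →
    IsSortedCondensation nodes edges (sccSort nodes edges)
  hamiltonPath : Finset D → Finset (D × D) → List D
  hamiltonPath_spec : ∀ S edges, IsTournament S edges → IsSCC S edges S →
    IsHamiltonPath S edges (hamiltonPath S edges)

/-! ### The fairness layer -/

/-- Types of the nodes. -/
inductive NodeType where
  | blank
  | shaded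
  | solid

/-- Is this node solid? -/
def NodeType.isSolid : NodeType → Bool
  | .solid => true
  | _ => false

/-- Is this node blank? -/
def NodeType.isBlank : NodeType → Bool
  | .blank => true
  | _ => false

/-- The dependency graph that was created in round `round`. -/
structure DepGraph (D : Type*) where
  round : ℕ
  nodes : Finset D
  edges : Finset (D × D)

/-- State of the fairness layer of a replica. The value `⊤` of an ordering indicator or of a round
means that none has been committed. `graphs` is the queue of dependency graphs, with its front
first. `deferred` holds the nodes that have to be added again to the next dependency graph
while the queue is empty. -/
structure FairState (n : ℕ) (D : Type*) where
  committedOis : D → Fin n → ℕ∞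
  committedRounds : D → Fin n → ℕ∞
  nodeType : D → NodeType
  graphOf : D → Option ℕ
  graphs : List (DepGraph D)
  deferred : List D
  ordered : Finset D
  finalOrder : List D

/-- The initial state of the fairness layer. -/
def FairState.initial (n : ℕ) (D : Type*) : FairState n D where
  committedOis := fun _ _ => ⊤
  committedRounds := fun _ _ => ⊤
  nodeType := fun _ => .blank
  graphOf := fun _ => none
  graphs := []
  deferred := []
  ordered := ∅
  finalOrder := []

section FairnessLayer

variable {n : ℕ} {D : Type*} [DecidableEq D]

/-- `x ≥ n - f`. -/
abbrev ReachesQuorum (n f x : ℕ) : Prop := n ≤ x + f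

/-- `x ≥ (n - f) / 2`, a comparison of rational numbers. -/
abbrev ReachesHalf (n f x : ℕ) : Prop := n ≤ 2 * x + f

namespace FairState

/-- The number of ordering indicators for `d` that are committed by round `r`. -/
def ap (st : FairState n D) (d : D) (r : ℕ) : ℕ :=
  (Finset.univ.filter fun i : Fin n => st.committedRounds d i ≤ (r : ℕ∞)).card

/-- The number of replicas that have a lower committed ordering indicator for `d₁` than for
`d₂`. -/
def weight (st : FairState n D) (d₁ d₂ : D) : ℕ :=
  (Finset.univ.filter fun i : Fin n => st.committedOis d₁ i < st.committedOis d₂ i).card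

/-- One of the two weights of the pair reaches `(n - f) / 2`. -/
abbrev PairReachesHalf (f : ℕ) (st : FairState n D) (d₁ d₂ : D) : Prop :=
  ReachesHalf n f (st.weight d₁ d₂) ∨ ReachesHalf n f (st.weight d₂ d₁)

/-- The edge for the pair `(d, d₂)` that the weights prefer. -/
def preferredEdge (st : FairState n D) (d d₂ : D) : D × D :=
  if st.weight d₂ d ≤ st.weight d d₂ then (d, d₂) else (d₂, d)

/-- The local orderings in the subdag `A`, as a sequence of triples (replica, digest, ordering
indicator). Transactions that are ordered already are skipped. -/
def entries (sub : Subroutines n D) (st : FairState n D) (A : Finset (Vertex n D)) :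
    List (Fin n × D × ℕ) :=
  ((sub.vertexIter A).flatMap fun v => v.localOrder.map fun e => (v.source, e.1, e.2)).filter
    fun e => e.2.1 ∉ st.ordered

/-- Record one committed ordering indicator. -/
def recordEntry (r : ℕ) (st : FairState n D) (e : Fin n × D × ℕ) : FairState n D :=
  { st with
    committedOis := Function.update st.committedOis e.2.1
      (Function.update (st.committedOis e.2.1) e.1 (e.2.2 : ℕ∞))
    committedRounds := Function.update st.committedRounds e.2.1
      (Function.update (st.committedRounds e.2.1) e.1 (r : ℕ∞)) }

/-- The type that a node with `x` committed ordering indicators gets, where `old` is kept if `x`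
is below both thresholds. -/
def classify (n f x : ℕ) (old : NodeType) : NodeType :=
  if ReachesQuorum n f x then .solid else if ReachesHalf n f x then .shaded else old

/-- Apply `F` to the dependency graph of round `r`. -/
def modifyGraph (st : FairState n D) (r : ℕ) (F : DepGraph D → DepGraph D) : FairState n D :=
  { st with graphs := st.graphs.map fun g => if g.round = r then F g else g }

/-- Classify the blank node `d`, and add it to the graph of round `r` if it is not blank any
more. -/
def addNode (f r : ℕ) (st : FairState n D) (d : D) : FairState n D :=
  if (st.nodeType d).isBlank ∧ ReachesHalf n f (st.ap d r) then
    { st with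
      nodeType := Function.update st.nodeType d (classify n f (st.ap d r) .blank)
      graphOf := Function.update st.graphOf d (some r) }.modifyGraph r
        fun g => { g with nodes := insert d g.nodes }
  else st

/-- The dependency graph in the queue that contains the node `d`, if there is one. -/
def graphFor (st : FairState n D) (d : D) : Option (DepGraph D) :=
  st.graphs.find? fun g => st.graphOf d = some g.round

/-- The pairs `(d, d₂)` of distinct nodes of one dependency graph, with `d` among the updated
nodes, one of whose weights reaches the threshold. -/
def addableEdges (f : ℕ) (st : FairState n D) (updated : Finset D) : Finset (D × D) :=
  updated.biUnion fun d =>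
    match st.graphFor d with
    | none => ∅
    | some g => (g.nodes.filter fun d₂ => d₂ ≠ d ∧ st.PairReachesHalf f d d₂).image (Prod.mk d)

/-- Add the edge for the pair `(d, d₂)` to the graph of `d`, unless there is an edge between the
two nodes already. -/
def addEdge (st : FairState n D) (q : D × D) : FairState n D :=
  match st.graphOf q.1 with
  | none => st
  | some r => st.modifyGraph r fun g =>
      if (q.1, q.2) ∈ g.edges ∨ (q.2, q.1) ∈ g.edges then g
      else { g with edges := insert (st.preferredEdge q.1 q.2) g.edges }

/-- Add the node `d` again, to the dependency graph `g`: classify it anew, and add the edges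
between `d` and the nodes of `g` for which a weight reaches the threshold. -/
def readdGraph (f : ℕ) (sub : Subroutines n D) (st : FairState n D) (g : DepGraph D) (d : D) :
    DepGraph D :=
  { g with
    nodes := insert d g.nodes
    edges := (sub.digestIter (g.nodes.erase d)).foldl
      (fun E d₂ => if st.PairReachesHalf f d d₂ then insert (st.preferredEdge d d₂) E else E)
      g.edges }

/-- Add the node `d` again, to the front graph of the queue. -/
def readdNode (f : ℕ) (sub : Subroutines n D) (st : FairState n D) (d : D) : FairState n D :=
  match st.graphs with
  | [] => st
  | g :: rest =>
    { st with
      nodeType := Function.update st.nodeType d (classify n f (st.ap d g.round) (st.nodeType d))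
      graphOf := Function.update st.graphOf d (some g.round)
      graphs := st.readdGraph f sub g d :: rest }

/-- Add all deferred nodes again, to the front graph, as soon as there is one. -/
def readdDeferred (f : ℕ) (sub : Subroutines n D) (st : FairState n D) : FairState n D :=
  match st.graphs with
  | [] => st
  | _ :: _ => st.deferred.foldl (readdNode f sub) { st with deferred := [] }

/-- Finalize the tournament `g` at the front of the queue, where `rest` is the rest of the queue:
the components up to the last one with a solid node are ordered, each along a Hamilton path, and
the nodes of the later components are added again to the next graph. -/
def finalizeFront (f : ℕ) (sub : Subroutines n D) (st : FairState n D) (g : DepGraph D)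
    (rest : List (DepGraph D)) : FairState n D :=
  let comps := sub.sccSort g.nodes g.edges
  let noSolid : Finset D → Bool := fun S => decide (∀ d ∈ S, (st.nodeType d).isSolid = false)
  let path := (comps.rdropWhile noSolid).flatMap fun S => sub.hamiltonPath S g.edges
  let later := (comps.rtakeWhile noSolid).flatMap sub.digestIter
  { st with
    graphs := rest
    deferred := later
    ordered := st.ordered ∪ path.toFinset
    finalOrder := st.finalOrder ++ path }.readdDeferred f sub

/-- Finalize graphs from the front of the queue until the front graph is not a tournament. The
first argument bounds the number of iterations; each iteration removes a graph. -/
def finalizeLoop (f : ℕ) (sub : Subroutines n D) : ℕ → FairState n D → FairState n D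
  | 0, st => st
  | k + 1, st =>
    match st.graphs with
    | [] => st
    | g :: rest =>
      if IsTournament g.nodes g.edges then
        finalizeLoop f sub k (st.finalizeFront f sub g rest)
      else st

/-- The finalization of the ordering at the end of each call of the fairness layer. -/
def orderFinalization (f : ℕ) (sub : Subroutines n D) (st : FairState n D) : FairState n D :=
  finalizeLoop f sub st.graphs.length (st.readdDeferred f sub)

/-- The reaction of the fairness layer to the subdag `A` of the committed leader of round `r`. -/
def handleSubdag (f : ℕ) (sub : Subroutines n D) (st : FairState n D) (r : ℕ)
    (A : Finset (Vertex n D)) : FairState n D :=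
  let es := st.entries sub A
  let updated : Finset D := (es.map fun e => e.2.1).toFinset
  let st₁ : FairState n D := { st with graphs := st.graphs ++ [⟨r, ∅, ∅⟩] }
  let st₂ := es.foldl (recordEntry r) st₁
  let st₃ := (sub.digestIter updated).foldl (addNode f r) st₂
  let st₄ := (sub.pairIter (st₃.addableEdges f updated)).foldl addEdge st₃
  st₄.orderFinalization f sub

end FairState

end FairnessLayer

/-! ### Replicas and executions -/

/-- The local state of a replica: the counter and the pending local ordering of the client thread;
the current round, the vertices broadcast so far, the local view of the DAG and the leader
vertices committed so far (in commit order) of the DAG layer; the subdags (with their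
rounds) sent to the fairness layer and not handled yet; the state of the fairness layer. -/
structure ReplicaState (n : ℕ) (D : Type*) where
  counter : ℕ
  pending : List (D × ℕ)
  currentRound : ℕ
  broadcast : List (Vertex n D)
  dag : Finset (Vertex n D)
  leaders : List (Vertex n D)
  inbox : List (ℕ × Finset (Vertex n D))
  fair : FairState n D

/-- The initial state of a replica. -/
def ReplicaState.initial (n : ℕ) (D : Type*) : ReplicaState n D where
  counter := 0
  pending := []
  currentRound := 0
  broadcast := []
  dag := ∅
  leaders := []
  inbox := []
  fair := FairState.initial n D

/-- What a replica may do at one instant: nothing; receive a transaction from a client; propose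
and reliably broadcast a vertex; add to its local view a vertex that reliable broadcast has
delivered; commit a leader vertex; let the fairness layer handle the next subdag. -/
inductive Event (n : ℕ) (Txn D : Type*) where
  | idle
  | receive (T : Txn)
  | propose (v : Vertex n D)
  | deliver (v : Vertex n D)
  | commit (L : Vertex n D)
  | order

open Classical in
/-- The code of a correct replica `i`: the event `e` takes it from the state `s` to `s'`. When a
leader vertex is committed is up to the commit rule of the underlying consensus protocol. -/
def Step {n : ℕ} {Txn D : Type*} [DecidableEq D] (f : ℕ) (sub : Subroutines n D)
    (digest : Txn → D) (valid : Txn → Prop) (i : Fin n) (s : ReplicaState n D) :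
    Event n Txn D → ReplicaState n D → Prop
  | .idle, s' => s' = s
  | .receive T, s' =>
      s' = if valid T then
          { s with
            counter := s.counter + 1
            pending := s.pending ++ [(digest T, s.counter + 1)] }
        else s
  | .propose v, s' =>
      v.source = i ∧ v.round = s.currentRound ∧ v.localOrder = s.pending ∧
      v.Valid f ∧ v.RefsPresent s.dag ∧
      s' = { s with
        pending := []
        currentRound := s.currentRound + 1
        broadcast := s.broadcast ++ [v] }
  | .deliver v, s' =>
      v.Valid f ∧ v.RefsPresent s.dag ∧ s' = { s with dag := insert v s.dag }
  | .commit L, s' =>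
      L ∈ s.dag ∧
      s' = { s with
        leaders := s.leaders ++ [L]
        inbox := s.inbox ++ [(L.round, subdag s.dag s.leaders L)] }
  | .order, s' =>
      match s.inbox with
      | [] => s' = s
      | (r, A) :: rest => s' = { s with inbox := rest, fair := s.fair.handleSubdag f sub r A }

/-- An execution of FairDAG-RL with `n` replicas, in discrete time. The replicas in `correct` are
never corrupted, and at most `f` others exist, whose behaviour is arbitrary. Vertices are
disseminated by reliable broadcast: a vertex of a correct source is delivered only if that
source has broadcast it, and no two different vertices with the same source and round are
delivered to correct replicas. The fairness layer of a correct replica does not stop while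
subdags wait for it. -/
structure Execution {n : ℕ} {Txn D : Type*} [DecidableEq D] (f : ℕ) (sub : Subroutines n D)
    (digest : Txn → D) (valid : Txn → Prop) where
  correct : Finset (Fin n)
  state : ℕ → Fin n → ReplicaState n D
  event : ℕ → Fin n → Event n Txn D
  byzantine_card : correctᶜ.card ≤ f
  starts : ∀ i ∈ correct, state 0 i = ReplicaState.initial n D
  steps : ∀ t, ∀ i ∈ correct, Step f sub digest valid i (state t i) (event t i) (state (t + 1) i)
  rbc_integrity : ∀ t, ∀ i ∈ correct, ∀ v, event t i = .deliver v →
    v.source ∈ correct → v ∈ (state t v.source).broadcast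
  rbc_consistency : ∀ t, ∀ i ∈ correct, ∀ v, event t i = .deliver v →
    ∀ t', ∀ j ∈ correct, ∀ w, event t' j = .deliver w →
    v.source = w.source → v.round = w.round → v = w
  fairness_progress : ∀ t, ∀ i ∈ correct, (state t i).inbox ≠ [] →
    ∃ t', t ≤ t' ∧ event t' i = .order

namespace Execution

variable {n : ℕ} {Txn D : Type*} [DecidableEq D] {f : ℕ} {sub : Subroutines n D}
  {digest : Txn → D} {valid : Txn → Prop}

/-- Replica `i` commits the leader vertex `L` at some time. -/
def Commits (E : Execution f sub digest valid) (i : Fin n) (L : Vertex n D) : Prop :=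
  ∃ t, L ∈ (E.state t i).leaders

/-- Replica `i` commits the leader vertex `L` before the leader vertex `L'`. -/
def CommitsBefore (E : Execution f sub digest valid) (i : Fin n) (L L' : Vertex n D) : Prop :=
  ∃ t, [L, L'].Sublist (E.state t i).leaders

/-- Agreement of the DAG-based consensus protocol: a leader vertex that one correct replica
commits is eventually committed by every correct replica. -/
def Agreement (E : Execution f sub digest valid) : Prop :=
  ∀ i ∈ E.correct, ∀ L, E.Commits i L → ∀ j ∈ E.correct, E.Commits j L

/-- Total ascending order of the DAG-based consensus protocol: if a correct replica commits `L`
before `L'`, then the round of `L` is smaller, and no correct replica commits `L'`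
before `L`. -/
def TotalAscendingOrder (E : Execution f sub digest valid) : Prop :=
  ∀ i ∈ E.correct, ∀ L L', E.CommitsBefore i L L' →
    L.round < L'.round ∧ ∀ j ∈ E.correct, ¬ E.CommitsBefore j L' L

/-- At time `t`, the final ordering of replica `i` has the transaction `T` (that is, its digest)
at position `p`. -/
def HasOrdered (E : Execution f sub digest valid) (t : ℕ) (i : Fin n) (T : Txn) (p : ℕ) : Prop :=
  (E.state t i).fair.finalOrder[p]? = some (digest T)

end Execution

end FairDAG

/-! The fairness layer is deterministic, so its state is a function of the sequence of subdags it
has handled, and handling one more subdag can only append to the final ordering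
(`finalOrder_handleAll_mono`). It therefore suffices that, from some time on, the sequence handled
by replica `j` extends the one handled by replica `i` at time `t`. Then position `p` is filled
identically and never changes.

Three facts give this. Any list of leaders committed by one correct replica is eventually a prefix
of the list of any other (`exists_leaders_prefix`): agreement makes the leaders common, and strictly
ascending rounds leave only one possible order. The subdag of a leader does not depend on the local
view in which it is computed (`causalHistory_congr`): views are closed under references, and
reliable broadcast allows one vertex per source and round. Every subdag sent to the fairness layer
is eventually handled (`exists_handled_length`).

The link between leaders and fairness state is the invariant `Handled`: handled subdags followed by
waiting ones form the log computed from the current view and all committed leaders. -/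

namespace FairDAG

/-! ### Causal histories and subdags are independent of the local view. -/

section CausalHistories

variable {n : ℕ} {D : Type*}

/-- Vertices of the two views with the same source and round are equal. -/
def Consistent (dag dag' : Finset (Vertex n D)) : Prop :=
  ∀ v ∈ dag, ∀ w ∈ dag', v.source = w.source → v.round = w.round → v = w

/-- A view that contains, with each vertex, everything that the vertex refers to. -/
def RefsClosed (dag : Finset (Vertex n D)) : Prop :=
  ∀ v ∈ dag, v.RefsPresent dag

theorem Consistent.symm {dag dag' : Finset (Vertex n D)} (h : Consistent dag dag') :
    Consistent dag' dag :=
  fun v hv w hw hs hr => (h w hw v hv hs.symm hr.symm).symm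

theorem Vertex.RefsPresent.mono {dag dag' : Finset (Vertex n D)} (h : dag ⊆ dag')
    {v : Vertex n D} (hv : v.RefsPresent dag) : v.RefsPresent dag' := by
  refine ⟨fun i hi => ?_, fun q hq => ?_⟩
  · obtain ⟨w, hw, h'⟩ := hv.1 i hi
    exact ⟨w, h hw, h'⟩
  · obtain ⟨w, hw, h'⟩ := hv.2 q hq
    exact ⟨w, h hw, h'⟩

theorem Vertex.RefsPresent.exists_of_references {dag : Finset (Vertex n D)} {v w : Vertex n D}
    (hv : v.RefsPresent dag) (h : v.References w) :
    ∃ w' ∈ dag, w'.source = w.source ∧ w'.round = w.round := by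
  rcases h with ⟨hr, hs⟩ | hw
  · obtain ⟨w', hw', hs', hr'⟩ := hv.1 _ hs
    exact ⟨w', hw', hs', by omega⟩
  · obtain ⟨w', hw', hs', hr'⟩ := hv.2 _ hw
    exact ⟨w', hw', hs', hr'⟩

/-- Induction along a path from `L`. A reference names its target by source and round only; closure
of `dag'` supplies a vertex with that name, and consistency identifies it with the one in `dag`. -/
theorem causalHistory_subset {dag dag' : Finset (Vertex n D)} (hc : Consistent dag dag')
    (hcl : RefsClosed dag') {L : Vertex n D} (hL : L ∈ dag') :
    causalHistory dag L ⊆ causalHistory dag' L := by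
  classical
  intro w hw
  simp only [causalHistory, Finset.mem_filter] at hw ⊢
  obtain ⟨-, hw⟩ := hw
  induction hw with
  | refl => exact ⟨hL, .refl⟩
  | @tail b c _ hbc ih =>
    obtain ⟨c', hc', hs, hr⟩ := (hcl b ih.1).exists_of_references hbc.2
    obtain rfl := hc c hbc.1 c' hc' hs.symm hr.symm
    exact ⟨hc', ih.2.tail ⟨hc', hbc.2⟩⟩

theorem causalHistory_congr {dag dag' : Finset (Vertex n D)} (hc : Consistent dag dag')
    (hcl : RefsClosed dag) (hcl' : RefsClosed dag') {L : Vertex n D} (hL : L ∈ dag)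
    (hL' : L ∈ dag') : causalHistory dag L = causalHistory dag' L :=
  (causalHistory_subset hc hcl' hL').antisymm (causalHistory_subset hc.symm hcl hL)

/-- The subdags, paired with their rounds, of leaders that are committed in the given order after
the leaders in `earlier`. -/
noncomputable def subdagLog (dag : Finset (Vertex n D)) :
    List (Vertex n D) → List (Vertex n D) → List (ℕ × Finset (Vertex n D))
  | _, [] => []
  | earlier, L :: rest => (L.round, subdag dag earlier L) :: subdagLog dag (earlier ++ [L]) rest

theorem length_subdagLog (dag : Finset (Vertex n D)) (earlier leaders : List (Vertex n D)) :
    (subdagLog dag earlier leaders).length = leaders.length := by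
  induction leaders generalizing earlier with
  | nil => rfl
  | cons L rest ih => simp [subdagLog, ih]

theorem subdagLog_append (dag : Finset (Vertex n D)) (earlier l₁ l₂ : List (Vertex n D)) :
    subdagLog dag earlier (l₁ ++ l₂) =
      subdagLog dag earlier l₁ ++ subdagLog dag (earlier ++ l₁) l₂ := by
  induction l₁ generalizing earlier with
  | nil => simp [subdagLog]
  | cons L rest ih => simp [subdagLog, ih]

theorem subdag_congr {dag dag' : Finset (Vertex n D)} {earlier : List (Vertex n D)}
    {L : Vertex n D} (he : ∀ K ∈ earlier, causalHistory dag K = causalHistory dag' K)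
    (hL : causalHistory dag L = causalHistory dag' L) :
    subdag dag earlier L = subdag dag' earlier L := by
  unfold subdag
  rw [hL, Finset.biUnion_congr rfl fun K hK => he K (List.mem_toFinset.1 hK)]

/-- The log sees the view only through the causal histories of the leaders. This serves both to
compare two replicas and to follow one replica while its view grows. -/
theorem subdagLog_congr {dag dag' : Finset (Vertex n D)} {earlier leaders : List (Vertex n D)}
    (he : ∀ K ∈ earlier, causalHistory dag K = causalHistory dag' K)
    (hl : ∀ K ∈ leaders, causalHistory dag K = causalHistory dag' K) :
    subdagLog dag earlier leaders = subdagLog dag' earlier leaders := by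
  induction leaders generalizing earlier with
  | nil => rfl
  | cons L rest ih =>
    have hL := hl L List.mem_cons_self
    rw [subdagLog, subdagLog, subdag_congr he hL, ih]
    · intro K hK
      rcases List.mem_append.1 hK with hK | hK
      · exact he K hK
      · rw [List.mem_singleton.1 hK, hL]
    · exact fun K hK => hl K (List.mem_cons_of_mem _ hK)

theorem subdagLog_prefix {dag dag' : Finset (Vertex n D)} {l l' : List (Vertex n D)}
    (hc : Consistent dag dag') (hcl : RefsClosed dag) (hcl' : RefsClosed dag')
    (hl : ∀ L ∈ l, L ∈ dag) (hl' : ∀ L ∈ l', L ∈ dag') (h : l <+: l') :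
    subdagLog dag [] l <+: subdagLog dag' [] l' := by
  obtain ⟨k, rfl⟩ := h
  rw [subdagLog_append, subdagLog_congr (dag := dag) (dag' := dag') (by simp)]
  · exact List.prefix_append _ _
  · exact fun L hL => causalHistory_congr hc hcl hcl' (hl L hL)
      (hl' L (List.mem_append_left _ hL))

end CausalHistories

/-! ### The final ordering grows only by appending. -/

section FinalOrder

variable {n : ℕ} {D : Type*} [DecidableEq D]

theorem foldl_preserves {α β γ : Type*} {g : β → α → β} (φ : β → γ)
    (h : ∀ b a, φ (g b a) = φ b) (b : β) (l : List α) : φ (l.foldl g b) = φ b := by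
  induction l generalizing b with
  | nil => rfl
  | cons a l ih => rw [List.foldl_cons, ih, h]

namespace FairState

theorem finalOrder_addNode (f r : ℕ) (st : FairState n D) (d : D) :
    (addNode f r st d).finalOrder = st.finalOrder := by
  unfold addNode modifyGraph
  split_ifs <;> rfl

theorem finalOrder_addEdge (st : FairState n D) (q : D × D) :
    (addEdge st q).finalOrder = st.finalOrder := by
  unfold addEdge modifyGraph
  split <;> rfl

theorem finalOrder_readdNode (f : ℕ) (sub : Subroutines n D) (st : FairState n D) (d : D) :
    (readdNode f sub st d).finalOrder = st.finalOrder := by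
  unfold readdNode
  split <;> rfl

theorem finalOrder_readdDeferred (f : ℕ) (sub : Subroutines n D) (st : FairState n D) :
    (readdDeferred f sub st).finalOrder = st.finalOrder := by
  unfold readdDeferred
  split
  · rfl
  · rw [foldl_preserves finalOrder (finalOrder_readdNode f sub)]

theorem finalOrder_prefix_finalizeFront (f : ℕ) (sub : Subroutines n D) (st : FairState n D)
    (g : DepGraph D) (rest : List (DepGraph D)) :
    st.finalOrder <+: (finalizeFront f sub st g rest).finalOrder := by
  unfold finalizeFront
  rw [finalOrder_readdDeferred]
  exact List.prefix_append _ _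

theorem finalOrder_prefix_finalizeLoop (f : ℕ) (sub : Subroutines n D) (k : ℕ)
    (st : FairState n D) : st.finalOrder <+: (finalizeLoop f sub k st).finalOrder := by
  induction k generalizing st with
  | zero => exact List.prefix_rfl
  | succ k ih =>
    unfold finalizeLoop
    split
    · exact List.prefix_rfl
    · split_ifs
      · exact (finalOrder_prefix_finalizeFront f sub st _ _).trans (ih _)
      · exact List.prefix_rfl

/-- Among all the phases, `finalizeFront` alone writes to the final ordering, and it appends;
recording, adding and re-adding nodes, and adding edges leave it untouched. -/
theorem finalOrder_prefix_handleSubdag (f : ℕ) (sub : Subroutines n D) (st : FairState n D)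
    (r : ℕ) (A : Finset (Vertex n D)) :
    st.finalOrder <+: (handleSubdag f sub st r A).finalOrder := by
  unfold handleSubdag orderFinalization
  refine List.IsPrefix.trans ?_ (finalOrder_prefix_finalizeLoop f sub _ _)
  rw [finalOrder_readdDeferred, foldl_preserves finalOrder finalOrder_addEdge,
    foldl_preserves finalOrder (finalOrder_addNode f r),
    foldl_preserves finalOrder (g := recordEntry r) fun _ _ => rfl]

/-- The state of the fairness layer after it has handled the given subdags. -/
def handleAll (f : ℕ) (sub : Subroutines n D) (st : FairState n D)
    (H : List (ℕ × Finset (Vertex n D))) : FairState n D :=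
  H.foldl (fun st q => st.handleSubdag f sub q.1 q.2) st

theorem finalOrder_prefix_handleAll (f : ℕ) (sub : Subroutines n D) (st : FairState n D)
    (H : List (ℕ × Finset (Vertex n D))) :
    st.finalOrder <+: (handleAll f sub st H).finalOrder := by
  induction H generalizing st with
  | nil => exact List.prefix_rfl
  | cons q H ih => exact (finalOrder_prefix_handleSubdag f sub st q.1 q.2).trans (ih _)

theorem finalOrder_handleAll_mono (f : ℕ) (sub : Subroutines n D) (st : FairState n D)
    {H H' : List (ℕ × Finset (Vertex n D))} (h : H <+: H') :
    (handleAll f sub st H).finalOrder <+: (handleAll f sub st H').finalOrder := by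
  obtain ⟨K, rfl⟩ := h
  have := finalOrder_prefix_handleAll f sub (handleAll f sub st H) K
  rwa [handleAll, handleAll, ← List.foldl_append] at this

end FairState

end FinalOrder

/-! ### Comparability of ascending lists. -/

/-- Two lists with ascending keys, each of which contains all entries of the other one with a key
below one of its own keys, are comparable. -/
theorem prefix_or_prefix_of_ascending {α : Type*} (key : α → ℕ) {a b : List α}
    (ha : a.Pairwise fun x y => key x < key y) (hb : b.Pairwise fun x y => key x < key y)
    (hab : ∀ x ∈ a, ∀ y ∈ b, key y < key x → y ∈ a)
    (hba : ∀ x ∈ a, ∀ y ∈ b, key x < key y → x ∈ b)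
    (heq : ∀ x ∈ a, ∀ y ∈ b, key x = key y → x = y) : a <+: b ∨ b <+: a := by
  induction a generalizing b with
  | nil => exact .inl List.nil_prefix
  | cons x a ih =>
    cases b with
    | nil => exact .inr List.nil_prefix
    | cons y b =>
      rw [List.pairwise_cons] at ha hb
      rcases lt_trichotomy (key x) (key y) with h | h | h
      -- Distinct head keys are impossible: the smaller head would have to occur in the other list,
      -- all of whose keys are larger.
      · rcases List.mem_cons.1 (hba x (by simp) y (by simp) h) with rfl | h'
        · exact absurd h (lt_irrefl _)
        · exact absurd (h.trans (hb.1 x h')) (lt_irrefl _)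
      · obtain rfl := heq x (by simp) y (by simp) h
        simp only [List.prefix_cons_inj]
        refine ih ha.2 hb.2 (fun u hu v hv huv => ?_) (fun u hu v hv huv => ?_)
          (fun u hu v hv huv => heq u (by simp [hu]) v (by simp [hv]) huv)
        -- The hypotheses pass to the tails because the common head has a smaller key than
        -- everything in either tail, so the member found is not the head.
        · rcases List.mem_cons.1 (hab u (by simp [hu]) v (by simp [hv]) huv) with rfl | h'
          · exact absurd (hb.1 v hv) (lt_irrefl _)
          · exact h'
        · rcases List.mem_cons.1 (hba u (by simp [hu]) v (by simp [hv]) huv) with rfl | h'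
          · exact absurd (ha.1 u hu) (lt_irrefl _)
          · exact h'
      · rcases List.mem_cons.1 (hab x (by simp) y (by simp) h) with rfl | h'
        · exact absurd h (lt_irrefl _)
        · exact absurd (h.trans (ha.1 y h')) (lt_irrefl _)

/-! ### Invariants of the runs of correct replicas. -/

namespace Execution

variable {n : ℕ} {Txn D : Type*} [DecidableEq D] {f : ℕ} {sub : Subroutines n D}
  {digest : Txn → D} {valid : Txn → Prop} (E : Execution f sub digest valid)

theorem exists_deliver_of_mem_dag {i : Fin n} (hi : i ∈ E.correct) {t : ℕ} {v : Vertex n D}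
    (hv : v ∈ (E.state t i).dag) : ∃ t', E.event t' i = .deliver v := by
  induction t with
  | zero => simp [E.starts i hi, ReplicaState.initial] at hv
  | succ t ih =>
    have hs := E.steps t i hi
    cases he : E.event t i with
    | idle => rw [he] at hs; exact ih (by rw [← show _ = _ from hs]; exact hv)
    | receive T =>
      rw [he] at hs
      simp only [Step] at hs
      rw [hs] at hv
      split_ifs at hv <;> exact ih hv
    | propose w =>
      rw [he] at hs
      rw [hs.2.2.2.2.2] at hv
      exact ih hv
    | deliver w =>
      rw [he] at hs
      rw [hs.2.2] at hv
      rcases Finset.mem_insert.1 hv with rfl | hv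
      · exact ⟨t, he⟩
      · exact ih hv
    | commit L =>
      rw [he] at hs
      rw [hs.2] at hv
      exact ih hv
    | order =>
      rw [he] at hs
      simp only [Step] at hs
      split at hs <;> rw [hs] at hv <;> exact ih hv

/-- Everything in a view was delivered, so `rbc_consistency` applies. The case `i = j` compares the
views of one replica at two times. -/
theorem consistent_dag {i j : Fin n} (hi : i ∈ E.correct) (hj : j ∈ E.correct) (t t' : ℕ) :
    Consistent (E.state t i).dag (E.state t' j).dag := by
  intro v hv w hw
  obtain ⟨a, ha⟩ := E.exists_deliver_of_mem_dag hi hv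
  obtain ⟨b, hb⟩ := E.exists_deliver_of_mem_dag hj hw
  exact E.rbc_consistency a i hi v ha b j hj w hb

/-- The local view is closed under references and contains the committed leaders. -/
structure DagInvariant (s : ReplicaState n D) : Prop where
  refsClosed : RefsClosed s.dag
  leaders_mem : ∀ L ∈ s.leaders, L ∈ s.dag

/-- The fairness layer has handled the subdags in `H`, and those in the inbox are the remaining
ones. -/
structure Handled (f : ℕ) (sub : Subroutines n D) (s : ReplicaState n D)
    (H : List (ℕ × Finset (Vertex n D))) : Prop where
  log : H ++ s.inbox = subdagLog s.dag [] s.leaders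
  fair : s.fair = (FairState.initial n D).handleAll f sub H

theorem dagInvariant {i : Fin n} (hi : i ∈ E.correct) (t : ℕ) : DagInvariant (E.state t i) := by
  induction t with
  | zero =>
    rw [E.starts i hi]
    exact ⟨by simp [RefsClosed, ReplicaState.initial], by simp [ReplicaState.initial]⟩
  | succ t ih =>
    have hs := E.steps t i hi
    cases he : E.event t i with
    | idle => rw [he] at hs; rw [show _ = _ from hs]; exact ih
    | receive T =>
      rw [he] at hs
      simp only [Step] at hs
      rw [hs]
      split_ifs
      · exact ⟨ih.1, ih.2⟩
      · exact ih
    | propose w =>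
      rw [he] at hs
      rw [hs.2.2.2.2.2]
      exact ⟨ih.1, ih.2⟩
    | deliver w =>
      rw [he] at hs
      obtain ⟨-, hw, hs⟩ := hs
      rw [hs]
      refine ⟨fun v hv => ?_, fun L hL => Finset.mem_insert_of_mem (ih.2 L hL)⟩
      rcases Finset.mem_insert.1 hv with rfl | hv
      · exact hw.mono (Finset.subset_insert _ _)
      · exact (ih.1 v hv).mono (Finset.subset_insert _ _)
    | commit L =>
      rw [he] at hs
      obtain ⟨hL, hs⟩ := hs
      rw [hs]
      refine ⟨ih.1, fun K hK => ?_⟩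
      rcases List.mem_append.1 hK with hK | hK
      · exact ih.2 K hK
      · rwa [List.mem_singleton.1 hK]
    | order =>
      rw [he] at hs
      simp only [Step] at hs
      split at hs <;> rw [hs]
      · exact ih
      · exact ⟨ih.1, ih.2⟩

theorem leaders_prefix_succ {i : Fin n} (hi : i ∈ E.correct) (t : ℕ) :
    (E.state t i).leaders <+: (E.state (t + 1) i).leaders := by
  have hs := E.steps t i hi
  cases he : E.event t i with
  | idle => rw [he] at hs; rw [show _ = _ from hs]
  | receive T =>
    rw [he] at hs
    simp only [Step] at hs
    rw [hs]
    split_ifs <;> exact List.prefix_rfl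
  | propose w => rw [he] at hs; rw [hs.2.2.2.2.2]
  | deliver w => rw [he] at hs; rw [hs.2.2]
  | commit L => rw [he] at hs; rw [hs.2]; exact List.prefix_append _ _
  | order =>
    rw [he] at hs
    simp only [Step] at hs
    split at hs <;> rw [hs]

theorem leaders_prefix {i : Fin n} (hi : i ∈ E.correct) {t t' : ℕ} (h : t ≤ t') :
    (E.state t i).leaders <+: (E.state t' i).leaders := by
  induction h with
  | refl => exact List.prefix_rfl
  | step _ ih => exact ih.trans (E.leaders_prefix_succ hi _)

/-- One step handles at most one subdag, and the next one if the event is `order`. -/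
theorem handled_succ {i : Fin n} (hi : i ∈ E.correct) {t : ℕ}
    {H : List (ℕ × Finset (Vertex n D))} (hH : Handled f sub (E.state t i) H) :
    ∃ H', Handled f sub (E.state (t + 1) i) H' ∧ H <+: H' ∧
      (E.event t i = .order → (E.state t i).inbox ≠ [] → H.length < H'.length) := by
  have hs := E.steps t i hi
  cases he : E.event t i with
  | idle =>
    rw [he] at hs
    rw [show _ = _ from hs]
    exact ⟨H, hH, List.prefix_rfl, by simp⟩
  | receive T =>
    rw [he] at hs
    simp only [Step] at hs
    refine ⟨H, ?_, List.prefix_rfl, by simp⟩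
    rw [hs]
    split_ifs
    · exact ⟨hH.1, hH.2⟩
    · exact hH
  | propose w =>
    rw [he] at hs
    refine ⟨H, ?_, List.prefix_rfl, by simp⟩
    rw [hs.2.2.2.2.2]
    exact ⟨hH.1, hH.2⟩
  | deliver w =>
    rw [he] at hs
    refine ⟨H, ⟨?_, ?_⟩, List.prefix_rfl, by simp⟩
    -- The log on the right of the invariant is now computed in a larger view, whereas the stored
    -- subdags come from older ones. Closure of the older view keeps the causal histories of
    -- committed leaders unchanged.
    · have inv := E.dagInvariant hi t
      have inv' := E.dagInvariant hi (t + 1)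
      have hl : (E.state (t + 1) i).leaders = (E.state t i).leaders := by rw [hs.2.2]
      have hb : (E.state (t + 1) i).inbox = (E.state t i).inbox := by rw [hs.2.2]
      rw [hb, hH.1, hl]
      exact subdagLog_congr (by simp) fun K hK =>
        causalHistory_congr (E.consistent_dag hi hi _ _) inv.1 inv'.1 (inv.2 K hK)
          (inv'.2 K (hl ▸ hK))
    · rw [hs.2.2]
      exact hH.2
  | commit L =>
    rw [he] at hs
    refine ⟨H, ?_, List.prefix_rfl, by simp⟩
    rw [hs.2]
    refine ⟨?_, hH.2⟩
    -- The new inbox entry is the last log entry: its subdag is taken relative to exactly the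
    -- leaders committed before.
    simp only [subdagLog_append, ← hH.1, List.append_assoc, List.nil_append]
    rfl
  | order =>
    rw [he] at hs
    simp only [Step] at hs
    split at hs
    · rename_i hb
      rw [hs]
      exact ⟨H, hH, List.prefix_rfl, fun _ h => absurd hb h⟩
    · rename_i r A rest hb
      refine ⟨H ++ [(r, A)], ?_, List.prefix_append _ _, by simp⟩
      rw [hs]
      refine ⟨?_, ?_⟩
      · rw [← hH.1, hb]
        simp
      · simp [hH.2, FairState.handleAll]

theorem exists_handled {i : Fin n} (hi : i ∈ E.correct) (t : ℕ) :
    ∃ H, Handled f sub (E.state t i) H := by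
  induction t with
  | zero =>
    rw [E.starts i hi]
    exact ⟨[], rfl, rfl⟩
  | succ t ih =>
    obtain ⟨H, hH⟩ := ih
    obtain ⟨H', hH', -⟩ := E.handled_succ hi hH
    exact ⟨H', hH'⟩

theorem handled_mono {i : Fin n} (hi : i ∈ E.correct) {t t' : ℕ} (h : t ≤ t')
    {H : List (ℕ × Finset (Vertex n D))} (hH : Handled f sub (E.state t i) H) :
    ∃ H', Handled f sub (E.state t' i) H' ∧ H <+: H' := by
  induction h with
  | refl => exact ⟨H, hH, List.prefix_rfl⟩
  | step _ ih =>
    obtain ⟨H', hH', hp⟩ := ih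
    obtain ⟨H'', hH'', hp', -⟩ := E.handled_succ hi hH'
    exact ⟨H'', hH'', hp.trans hp'⟩

/-- Every subdag that is sent to the fairness layer is eventually handled. -/
theorem exists_handled_length {i : Fin n} (hi : i ∈ E.correct) (t k : ℕ)
    (hk : k ≤ (E.state t i).leaders.length) :
    ∃ t', t ≤ t' ∧ ∃ H, Handled f sub (E.state t' i) H ∧ k ≤ H.length := by
  induction k with
  | zero =>
    obtain ⟨H, hH⟩ := E.exists_handled hi t
    exact ⟨t, le_rfl, H, hH, Nat.zero_le _⟩
  | succ k ih =>
    obtain ⟨t₁, ht₁, H₁, hH₁, hk₁⟩ := ih (by omega)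
    by_cases hb : (E.state t₁ i).inbox = []
    -- With an empty inbox the whole log has been handled, and its length is the current number of
    -- leaders, which is at least that at time `t`.
    · have := congrArg List.length hH₁.1
      have hl := (E.leaders_prefix hi ht₁).length_le
      rw [hb, List.append_nil, length_subdagLog] at this
      exact ⟨t₁, ht₁, H₁, hH₁, by omega⟩
    · obtain ⟨t₂, ht₂, he⟩ := E.fairness_progress t₁ i hi hb
      obtain ⟨H₂, hH₂, hp⟩ := E.handled_mono hi ht₂ hH₁
      have hp' := hp.length_le
      -- The inbox was nonempty at `t₁`, but may have been emptied before the `order` event at `t₂`;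
      -- in that case everything is handled already.
      by_cases hb₂ : (E.state t₂ i).inbox = []
      · have := congrArg List.length hH₂.1
        have hl := (E.leaders_prefix hi (ht₁.trans ht₂)).length_le
        rw [hb₂, List.append_nil, length_subdagLog] at this
        exact ⟨t₂, ht₁.trans ht₂, H₂, hH₂, by omega⟩
      · obtain ⟨H₃, hH₃, -, hlt⟩ := E.handled_succ hi hH₂
        have := hlt he hb₂
        exact ⟨t₂ + 1, by omega, H₃, hH₃, by omega⟩

/-! ### Correct replicas commit the same leader sequence. -/

variable {E}

theorem TotalAscendingOrder.pairwise_leaders (horder : E.TotalAscendingOrder) {i : Fin n}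
    (hi : i ∈ E.correct) (t : ℕ) :
    (E.state t i).leaders.Pairwise fun L L' => L.round < L'.round := by
  rw [List.pairwise_iff_forall_sublist]
  exact fun {L L'} h => (horder i hi L L' ⟨t, h⟩).1

/-- A leader that some correct replica commits, with a round below that of a leader in the list of
`i`, is in that list. -/
theorem mem_leaders_of_round_lt (hagree : E.Agreement) (horder : E.TotalAscendingOrder)
    {i j : Fin n} (hi : i ∈ E.correct) (hj : j ∈ E.correct) {t t' : ℕ} {L L' : Vertex n D}
    (hL : L ∈ (E.state t i).leaders) (hL' : L' ∈ (E.state t' j).leaders)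
    (h : L'.round < L.round) : L' ∈ (E.state t i).leaders := by
  obtain ⟨u, hu⟩ := hagree j hj L' ⟨t', hL'⟩ i hi
  have hu' := (E.leaders_prefix hi (le_max_right t u)).subset hu
  -- At time `max t u` the list of `i` holds both leaders and extends the list at time `t`. Leaders
  -- appended after `t` have rounds above that of `L`, so `L'` is not among them.
  have hpw := horder.pairwise_leaders hi (max t u)
  obtain ⟨K, hK⟩ := E.leaders_prefix hi (le_max_left t u)
  rw [← hK] at hu' hpw
  rcases List.mem_append.1 hu' with hm | hm
  · exact hm
  · exact absurd ((List.pairwise_append.1 hpw).2.2 L hL L' hm) (by omega)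

/-- Agreement brings `L'` into the list of `i` itself, where rounds are pairwise distinct. -/
theorem eq_of_round_eq (hagree : E.Agreement) (horder : E.TotalAscendingOrder)
    {i j : Fin n} (hi : i ∈ E.correct) (hj : j ∈ E.correct) {t t' : ℕ} {L L' : Vertex n D}
    (hL : L ∈ (E.state t i).leaders) (hL' : L' ∈ (E.state t' j).leaders)
    (h : L.round = L'.round) : L = L' := by
  obtain ⟨u, hu⟩ := hagree j hj L' ⟨t', hL'⟩ i hi
  have hu' := (E.leaders_prefix hi (le_max_right t u)).subset hu
  have hL₂ := (E.leaders_prefix hi (le_max_left t u)).subset hL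
  exact List.inj_on_of_nodup_map (List.pairwise_map.2
    ((horder.pairwise_leaders hi (max t u)).imp fun h => h.ne)) hL₂ hu' h

/-- Any two correct replicas commit the same leaders in the same order. -/
theorem exists_leaders_prefix (hagree : E.Agreement) (horder : E.TotalAscendingOrder)
    {i j : Fin n} (hi : i ∈ E.correct) (hj : j ∈ E.correct) (t : ℕ) :
    ∃ t', (E.state t i).leaders <+: (E.state t' j).leaders := by
  rcases List.eq_nil_or_concat (E.state t i).leaders with h | ⟨K, L, h⟩
  · exact ⟨0, h ▸ List.nil_prefix⟩
  · have hL : L ∈ (E.state t i).leaders := by simp [h]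
    obtain ⟨u, hu⟩ := hagree i hi L ⟨t, hL⟩ j hj
    refine ⟨u, ?_⟩
    rcases prefix_or_prefix_of_ascending Vertex.round (horder.pairwise_leaders hi t)
      (horder.pairwise_leaders hj u)
      (fun x hx y hy hxy => mem_leaders_of_round_lt hagree horder hi hj hx hy hxy)
      (fun x hx y hy hxy => mem_leaders_of_round_lt hagree horder hj hi hy hx hxy)
      (fun x hx y hy hxy => eq_of_round_eq hagree horder hi hj hx hy hxy) with hp | hp
    · exact hp
    · have hpw := horder.pairwise_leaders hi t
      rw [h, List.concat_eq_append] at hp hpw ⊢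
      -- If the list of `j` is the shorter one, it still contains `L`. A proper prefix would lie
      -- within `K`, putting `L` strictly below its own round.
      rcases List.prefix_concat_iff.1 hp with hp | hp
      · rw [hp]
      · exact absurd ((List.pairwise_append.1 hpw).2.2 L (hp.subset hu) L (by simp))
          (lt_irrefl _)

end Execution

end FairDAG

/-! ### The safety theorem. -/

theorem mainTheorem4 {n : ℕ} {Txn D : Type*} [DecidableEq D] (f : ℕ) (γ : ℝ)
    (hγ : 1 / 2 < γ) (hγ1 : γ ≤ 1) (hn : (2 * γ + 1) * (f : ℝ) / (2 * γ - 1) < (n : ℝ))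
    (sub : FairDAG.Subroutines n D) (digest : Txn → D) (valid : Txn → Prop)
    (E : FairDAG.Execution f sub digest valid)
    (hagree : E.Agreement) (horder : E.TotalAscendingOrder)
    (i : Fin n) (hi : i ∈ E.correct) (T : Txn) (p t : ℕ) (hT : E.HasOrdered t i T p) :
    ∀ j ∈ E.correct, ∃ t₀ : ℕ, ∀ t', t₀ ≤ t' → E.HasOrdered t' j T p := by
  intro j hj
  obtain ⟨H, hH⟩ := E.exists_handled hi t
  obtain ⟨t₁, hp⟩ := FairDAG.Execution.exists_leaders_prefix hagree horder hi hj t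
  -- By `t₀`, replica `j` has handled as many subdags as `i` had committed leaders at time `t`,
  -- hence at least as many as `i` had handled by then.
  obtain ⟨t₀, ht₀, H₀, hH₀, hlen₀⟩ := E.exists_handled_length hj t₁ _ hp.length_le
  refine ⟨t₀, fun t' ht' => ?_⟩
  obtain ⟨H', hH', hp'⟩ := E.handled_mono hj ht' hH₀
  have inv := E.dagInvariant hi t
  have inv' := E.dagInvariant hj t'
  have hlog := FairDAG.subdagLog_prefix (E.consistent_dag hi hj t t') inv.1 inv'.1 inv.2 inv'.2
    (hp.trans (E.leaders_prefix hj (ht₀.trans ht')))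
  have hlen : H.length ≤ H'.length := by
    have h₁ := congrArg List.length hH.1
    rw [List.length_append, FairDAG.length_subdagLog] at h₁
    have h₂ := hp'.length_le
    omega
  have hHH' : H <+: H' := by
    -- Both sequences are prefixes of the log of `j` at time `t'`, so their lengths decide which
    -- extends which.
    refine List.prefix_of_prefix_length_le (l₃ := FairDAG.subdagLog (E.state t' j).dag []
      (E.state t' j).leaders) ?_ ?_ hlen
    · exact List.IsPrefix.trans (hH.1 ▸ List.prefix_append _ _) hlog
    · exact hH'.1 ▸ List.prefix_append _ _
  have hfin := FairDAG.FairState.finalOrder_handleAll_mono f sub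
    (FairDAG.FairState.initial n D) hHH'
  rw [← hH.2, ← hH'.2] at hfin
  obtain ⟨K, hK⟩ := hfin
  have hp : p < (E.state t i).fair.finalOrder.length := (List.getElem?_eq_some_iff.1 hT).1
  rw [FairDAG.Execution.HasOrdered, ← hK, List.getElem?_append_left hp]
  exact hT
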